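/- For integers $r,s,t\ge 0$, the firefly graph $F_{r,s,t}$ is the graph on $2r+s+2t+1$ vertices that consists of $r$ triangles, $s$ pendant edges and $t$ pendant paths of length $2$, all sharing one common vertex and otherwise disjoint. For a finite simple graph $G$ on at least two vertices with $e(G)$ edges, adjacency matrix $A$ and diagonal degree matrix $D$, let $q_1(G)\ge q_2(G)\ge\cdots$ be the eigenvalues, with multiplicity, of the signless Laplacian $Q(G)=A+D$, and put $S_2(G)=q_1(G)+q_2(G)$ and $f(G)=e(G)+3-S_2(G)$. Let $G$ be (isomorphic to) $F_{r,s,t}$ with $r\ge 2$, $s\ge 1$ and $t\ge 1$. Then $$S_2(G)\le e(G)+2.5,$$ and hence $f(G)\ge 0.5$. -/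

import Mathlib

open Finset

noncomputable section

/-- The signless Laplacian `Q(G) = A(G) + D(G)` over the reals. -/
def signlessLaplacian {V : Type*} [Fintype V] [DecidableEq V]
    (G : SimpleGraph V) [DecidableRel G.Adj] : Matrix V V ℝ :=
  G.adjMatrix ℝ + G.degMatrix ℝ

theorem signlessLaplacian_isHermitian {V : Type*} [Fintype V] [DecidableEq V]
    (G : SimpleGraph V) [DecidableRel G.Adj] : (signlessLaplacian G).IsHermitian :=
  (G.isHermitian_adjMatrix ℝ).add (G.isHermitian_degMatrix ℝ)

/-- `qEigenvalue G k` is `q_k(G)`, the `k`-th largest eigenvalue (counted with multiplicity) of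
`Q(G)`, for `1 ≤ k ≤ |V|`; outside this range the value is `0`.
(`eigenvalues₀` lists the eigenvalues in non-increasing order, starting from index `0`.) -/
def qEigenvalue {V : Type*} [Fintype V] [DecidableEq V]
    (G : SimpleGraph V) [DecidableRel G.Adj] (k : ℕ) : ℝ :=
  if h : 1 ≤ k ∧ k ≤ Fintype.card V then
    (signlessLaplacian_isHermitian G).eigenvalues₀ ⟨k - 1, by omega⟩
  else 0

/-- `S_2(G) = q_1(G) + q_2(G)`. -/
def signlessS2 {V : Type*} [Fintype V] [DecidableEq V]
    (G : SimpleGraph V) [DecidableRel G.Adj] : ℝ :=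
  qEigenvalue G 1 + qEigenvalue G 2

/-- `f(G) = e(G) + 3 - S_2(G)`. -/
def signlessGap {V : Type*} [Fintype V] [DecidableEq V]
    (G : SimpleGraph V) [DecidableRel G.Adj] : ℝ :=
  (#G.edgeFinset : ℝ) + 3 - signlessS2 G

end

/-- The `1 + 2r + s + 2t` vertices of the firefly `F_{r,s,t}`: the common vertex, the two further
vertices of each of the `r` triangles, the ends of the `s` pendant edges, and the two further
vertices of each of the `t` pendant paths (`0`: middle vertex, `1`: end vertex). -/
abbrev FireflyVertex (r s t : ℕ) : Type :=
  Unit ⊕ ((Fin r × Fin 2) ⊕ (Fin s ⊕ (Fin t × Fin 2)))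

/-- A relation generating the edges of the firefly `F_{r,s,t}`. -/
def fireflyRel (r s t : ℕ) : FireflyVertex r s t → FireflyVertex r s t → Prop
  | .inl _, .inr (.inl _) => True
  | .inr (.inl (i, _)), .inr (.inl (j, _)) => i = j
  | .inl _, .inr (.inr (.inl _)) => True
  | .inl _, .inr (.inr (.inr (_, a))) => a = 0
  | .inr (.inr (.inr (i, _))), .inr (.inr (.inr (j, _))) => i = j
  | _, _ => False

/-- The firefly graph `F_{r,s,t}`: `r` triangles, `s` pendant edges and `t` pendant paths of
length `2`, all sharing one common vertex. (`SimpleGraph.fromRel` symmetrizes the relation and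
discards loops.) -/
def fireflyGraph (r s t : ℕ) : SimpleGraph (FireflyVertex r s t) :=
  SimpleGraph.fromRel (fireflyRel r s t)

/-! The form of `Q` is the sum of `(x u + x v) ^ 2` over edges, so both eigenvalues can be bounded
variationally. Let `d = 2r + s + t` be the degree of the centre. A weighted AM-GM on the edges at
the centre gives `q₁ ≤ d + 2`. Deleting the centre leaves only disjoint edges and isolated vertices,
so the form is at most `3 ‖x‖²` on the hyperplane `x c = 0`, and Courant–Fischer gives `q₂ ≤ 3`.
Since `e(G) = d + r + t`, the claim reduces to `r + t ≥ 5/2`. -/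

/-- Summing a symmetric edge weight over the ordered adjacent pairs of a firefly graph. -/
theorem sum_adj_fireflyGraph (r s t : ℕ) [DecidableRel (fireflyGraph r s t).Adj]
    (g : FireflyVertex r s t → FireflyVertex r s t → ℝ) (hg : ∀ u v, g u v = g v u) :
    (∑ u, ∑ v, if (fireflyGraph r s t).Adj u v then g u v else 0) =
      2 * ((∑ i, (g (.inl ()) (.inr (.inl (i, 0))) + g (.inl ()) (.inr (.inl (i, 1)))
          + g (.inr (.inl (i, 0))) (.inr (.inl (i, 1)))))
        + (∑ k, g (.inl ()) (.inr (.inr (.inl k))))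
        + ∑ j, (g (.inl ()) (.inr (.inr (.inr (j, 0))))
          + g (.inr (.inr (.inr (j, 0)))) (.inr (.inr (.inr (j, 1)))))) := by
  have e1 : ∀ x i, g (.inr x) (.inl i) = g (.inl i) (.inr x) := fun _ _ => hg _ _
  have e2 : ∀ i : Fin r, g (.inr (.inl (i, 1))) (.inr (.inl (i, 0))) =
    g (.inr (.inl (i, 0))) (.inr (.inl (i, 1))) := fun _ => hg _ _
  have e3 : ∀ i : Fin t, g (.inr (.inr (.inr (i, 1)))) (.inr (.inr (.inr (i, 0)))) =
    g (.inr (.inr (.inr (i, 0)))) (.inr (.inr (.inr (i, 1)))) := fun _ => hg _ _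
  have hor : ∀ {n : ℕ} (i j : Fin n), (i = j ∨ j = i) ↔ i = j := by
    intro n i j; constructor
    · rintro (h | h) <;> simp [h]
    · exact Or.inl
  simp only [Fintype.sum_sum_type, Fintype.sum_prod_type, Fin.sum_univ_two, fireflyGraph,
    SimpleGraph.fromRel_adj, fireflyRel]
  simp [Finset.sum_add_distrib, hor, e1, e2, e3]
  ring

/-- The degree term sums `x i ^ 2` over ordered adjacent pairs; averaging with the swapped sum
completes the square. -/
theorem dotProduct_signlessLaplacian_mulVec {V : Type*} [Fintype V] [DecidableEq V]
    (G : SimpleGraph V) [DecidableRel G.Adj] (x : V → ℝ) :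
    x ⬝ᵥ (signlessLaplacian G).mulVec x =
      (∑ i, ∑ j, if G.Adj i j then (x i + x j) ^ 2 else 0) / 2 := by
  open SimpleGraph in
  simp_rw [signlessLaplacian, Matrix.add_mulVec, dotProduct_add, dotProduct_mulVec_degMatrix,
    dotProduct_mulVec_adjMatrix, ← sum_add_distrib, degree_eq_sum_if_adj, sum_mul, ite_mul, one_mul,
    zero_mul, ← sum_add_distrib, ite_add_ite, add_zero]
  rw [← add_self_div_two (∑ x_1 : V, ∑ x_2 : V, _)]
  conv_lhs => enter [1, 2, 2, i, 2, j]; rw [if_congr (G.adj_comm i j) rfl rfl]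
  conv_lhs => enter [1, 2]; rw [Finset.sum_comm]
  simp_rw [← sum_add_distrib, ite_add_ite]
  congr 2 with i
  congr 2 with j
  ring_nf

theorem card_edgeFinset_fireflyGraph (r s t : ℕ) [DecidableRel (fireflyGraph r s t).Adj] :
    ((fireflyGraph r s t).edgeFinset.card : ℝ) = 3 * r + s + 2 * t := by
  -- With weight `1` the double sum is the degree sum, twice the number of edges.
  have h := sum_adj_fireflyGraph r s t (fun _ _ => 1) (fun _ _ => rfl)
  simp_rw [← SimpleGraph.degree_eq_sum_if_adj] at h
  have h2 := congrArg (Nat.cast (R := ℝ)) (fireflyGraph r s t).sum_degrees_eq_twice_card_edges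
  push_cast at h2
  rw [h2] at h
  simp at h
  linarith

theorem dotProduct_signlessLaplacian_fireflyGraph (r s t : ℕ)
    [DecidableRel (fireflyGraph r s t).Adj] (x : FireflyVertex r s t → ℝ) :
    x ⬝ᵥ (signlessLaplacian (fireflyGraph r s t)).mulVec x =
      (∑ i, ((x (.inl ()) + x (.inr (.inl (i, 0)))) ^ 2 + (x (.inl ()) + x (.inr (.inl (i, 1)))) ^ 2
          + (x (.inr (.inl (i, 0))) + x (.inr (.inl (i, 1)))) ^ 2))
        + (∑ k, (x (.inl ()) + x (.inr (.inr (.inl k)))) ^ 2)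
        + ∑ j, ((x (.inl ()) + x (.inr (.inr (.inr (j, 0))))) ^ 2
          + (x (.inr (.inr (.inr (j, 0)))) + x (.inr (.inr (.inr (j, 1))))) ^ 2) := by
  rw [dotProduct_signlessLaplacian_mulVec,
    sum_adj_fireflyGraph r s t (fun u v => (x u + x v) ^ 2) (fun u v => by ring)]
  ring

theorem dotProduct_self_fireflyVertex (r s t : ℕ) (x : FireflyVertex r s t → ℝ) :
    x ⬝ᵥ x = x (.inl ()) ^ 2
      + (∑ i, (x (.inr (.inl (i, 0))) ^ 2 + x (.inr (.inl (i, 1))) ^ 2))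
      + (∑ k, x (.inr (.inr (.inl k))) ^ 2)
      + ∑ j, (x (.inr (.inr (.inr (j, 0)))) ^ 2 + x (.inr (.inr (.inr (j, 1)))) ^ 2) := by
  simp [dotProduct, Fintype.sum_sum_type, Fintype.sum_prod_type, ← sq, add_assoc]

/-- On vectors vanishing at the common vertex, the form of `Q` is at most `3 ‖x‖²`. -/
theorem fireflyGraph_form_le_of_center_eq_zero (r s t : ℕ)
    [DecidableRel (fireflyGraph r s t).Adj] (x : FireflyVertex r s t → ℝ) (hx : x (.inl ()) = 0) :
    x ⬝ᵥ (signlessLaplacian (fireflyGraph r s t)).mulVec x ≤ 3 * (x ⬝ᵥ x) := by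
  rw [dotProduct_signlessLaplacian_fireflyGraph, dotProduct_self_fireflyVertex, hx]
  simp only [mul_add, Finset.mul_sum]
  refine add_le_add (add_le_add ?_ ?_) ?_
  · refine (Finset.sum_le_sum fun i _ => ?_).trans (le_add_of_nonneg_left (by norm_num))
    nlinarith [sq_nonneg (x (.inr (.inl (i, 0))) - x (.inr (.inl (i, 1))))]
  · refine Finset.sum_le_sum fun k _ => ?_
    nlinarith [sq_nonneg (x (.inr (.inr (.inl k))))]
  · refine Finset.sum_le_sum fun j _ => ?_
    nlinarith [sq_nonneg (x (.inr (.inr (.inr (j, 0)))) - x (.inr (.inr (.inr (j, 1))))),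
      sq_nonneg (x (.inr (.inr (.inr (j, 1)))))]

/-- The form of `Q` is at most `(d + 2) ‖x‖²`, where `d` is the degree of the common vertex. -/
theorem fireflyGraph_form_le (r s t : ℕ) (hr : 1 ≤ r) [DecidableRel (fireflyGraph r s t).Adj]
    (x : FireflyVertex r s t → ℝ) :
    x ⬝ᵥ (signlessLaplacian (fireflyGraph r s t)).mulVec x ≤
      (2 * r + s + t + 2) * (x ⬝ᵥ x) := by
  rw [dotProduct_signlessLaplacian_fireflyGraph, dotProduct_self_fireflyVertex]
  set c := x (.inl ())
  set d : ℝ := 2 * r + s + t with hd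
  have hr' : (1 : ℝ) ≤ r := by exact_mod_cast hr
  have hd2 : 2 ≤ d := by
    have h1 : (0 : ℝ) ≤ s := by positivity
    have h2 : (0 : ℝ) ≤ t := by positivity
    linarith
  -- The weight is chosen so that `d` copies of `1 + 2 / d` give `c ^ 2` the coefficient `d + 2`. A
  -- non-central edge adds at most `2` to the coefficient `1 + d / 2` of `a ^ 2`, and `3 + d / 2 ≤ d
  -- + 2` because `d ≥ 2`.
  have key : ∀ a : ℝ, (c + a) ^ 2 ≤ (1 + 2 / d) * c ^ 2 + (1 + d / 2) * a ^ 2 := by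
    intro a
    have h : (1 + 2 / d) * c ^ 2 + (1 + d / 2) * a ^ 2 - (c + a) ^ 2 =
        2 / d * (c - d / 2 * a) ^ 2 := by
      field_simp
      ring
    have : 0 ≤ 2 / d * (c - d / 2 * a) ^ 2 := by positivity
    linarith
  have h1 : ∀ a : ℝ, 0 ≤ (d - 2) * a ^ 2 := fun a =>
    mul_nonneg (by linarith) (sq_nonneg a)
  have hT : ∀ a b : ℝ, (c + a) ^ 2 + (c + b) ^ 2 + (a + b) ^ 2 ≤
      2 * ((1 + 2 / d) * c ^ 2) + (d + 2) * (a ^ 2 + b ^ 2) := fun a b => by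
    nlinarith [key a, key b, h1 a, h1 b, sq_nonneg (a - b)]
  have hS : ∀ a : ℝ, (c + a) ^ 2 ≤ (1 + 2 / d) * c ^ 2 + (d + 2) * a ^ 2 := fun a => by
    nlinarith [key a, h1 a, sq_nonneg a]
  have hP : ∀ a b : ℝ, (c + a) ^ 2 + (a + b) ^ 2 ≤
      (1 + 2 / d) * c ^ 2 + (d + 2) * (a ^ 2 + b ^ 2) := fun a b => by
    nlinarith [key a, h1 a, h1 b, sq_nonneg (a - b), sq_nonneg b]
  have hc : (d + 2) * c ^ 2 = d * ((1 + 2 / d) * c ^ 2) := by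
    field_simp
  have split {n : ℕ} (K : ℝ) (f : Fin n → ℝ) :
      ∑ i, (K + (d + 2) * f i) = n * K + (d + 2) * ∑ i, f i := by
    simp [Finset.sum_add_distrib, Finset.mul_sum]
  refine (add_le_add (add_le_add (Finset.sum_le_sum fun i _ => hT _ _)
    (Finset.sum_le_sum fun k _ => hS _)) (Finset.sum_le_sum fun j _ => hP _ _)).trans (le_of_eq ?_)
  rw [split, split, split]
  linear_combination -hc - (1 + 2 / d) * c ^ 2 * hd

/-- A graph isomorphism preserves the quadratic form of the signless Laplacian. -/
theorem dotProduct_signlessLaplacian_iso {V W : Type*} [Fintype V] [DecidableEq V] [Fintype W]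
    [DecidableEq W] {G : SimpleGraph V} {H : SimpleGraph W} [DecidableRel G.Adj]
    [DecidableRel H.Adj] (e : G ≃g H) (x : V → ℝ) :
    x ⬝ᵥ (signlessLaplacian G).mulVec x =
      (x ∘ e.symm) ⬝ᵥ (signlessLaplacian H).mulVec (x ∘ e.symm) := by
  rw [dotProduct_signlessLaplacian_mulVec, dotProduct_signlessLaplacian_mulVec]
  congr 1
  refine Fintype.sum_equiv e.toEquiv _ _ fun i => Fintype.sum_equiv e.toEquiv _ _ fun j => ?_
  have h : H.Adj (e i) (e j) ↔ G.Adj i j := e.map_adj_iff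
  simp [h]

namespace Matrix.IsHermitian

variable {n : Type*} [Fintype n] [DecidableEq n] {A : Matrix n n ℝ} (hA : A.IsHermitian)

theorem eigenvectorBasis_dotProduct (i j : n) :
    (hA.eigenvectorBasis i : n → ℝ) ⬝ᵥ (hA.eigenvectorBasis j : n → ℝ) =
      if i = j then 1 else 0 := by
  have h := orthonormal_iff_ite.mp hA.eigenvectorBasis.orthonormal i j
  rw [← h, EuclideanSpace.inner_eq_star_dotProduct, dotProduct_comm]
  simp

/-- An upper bound for the quadratic form bounds every eigenvalue. -/
theorem eigenvalues_le_of_form_le {a : ℝ} (h : ∀ x : n → ℝ, x ⬝ᵥ A.mulVec x ≤ a * (x ⬝ᵥ x))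
    (i : n) : hA.eigenvalues i ≤ a := by
  have := h (hA.eigenvectorBasis i)
  rw [hA.mulVec_eigenvectorBasis, dotProduct_smul, hA.eigenvectorBasis_dotProduct] at this
  simpa using this

/-- An upper bound for the quadratic form on a coordinate hyperplane bounds the smaller of any two
eigenvalues. -/
theorem eigenvalues_le_of_form_le_of_apply_eq_zero {b : ℝ} (c : n)
    (h : ∀ x : n → ℝ, x c = 0 → x ⬝ᵥ A.mulVec x ≤ b * (x ⬝ᵥ x)) {i j : n} (hij : i ≠ j)
    (hle : hA.eigenvalues j ≤ hA.eigenvalues i) : hA.eigenvalues j ≤ b := by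
  -- The plane spanned by two eigenvectors meets the hyperplane in a nonzero vector, where the form
  -- is at least the smaller eigenvalue times the squared norm.
  obtain ⟨α, β, hne, h0⟩ : ∃ α β : ℝ, 0 < α ^ 2 + β ^ 2 ∧
      α * hA.eigenvectorBasis i c + β * hA.eigenvectorBasis j c = 0 := by
    by_cases hz : hA.eigenvectorBasis i c = 0
    · exact ⟨1, 0, by norm_num, by simp [hz]⟩
    · exact ⟨-hA.eigenvectorBasis j c, hA.eigenvectorBasis i c, by positivity, by ring⟩
  have := h (α • (hA.eigenvectorBasis i : n → ℝ) + β • (hA.eigenvectorBasis j : n → ℝ))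
    (by simpa using h0)
  simp only [mulVec_add, mulVec_smul, hA.mulVec_eigenvectorBasis, dotProduct_add, add_dotProduct,
    dotProduct_smul, smul_dotProduct, hA.eigenvectorBasis_dotProduct, hij, hij.symm, if_true,
    if_false, smul_eq_mul] at this
  by_contra! hb
  nlinarith [mul_pos (sub_pos.mpr hb) hne, mul_nonneg (sub_nonneg.mpr hle) (sq_nonneg α)]

end Matrix.IsHermitian

theorem mainTheorem2 (r s t : ℕ) (hr : 2 ≤ r) (hs : 1 ≤ s) (ht : 1 ≤ t)
    {V : Type*} [Fintype V] [DecidableEq V] (G : SimpleGraph V) [DecidableRel G.Adj]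
    (hG : Nonempty (G ≃g fireflyGraph r s t)) :
    signlessS2 G ≤ (G.edgeFinset.card : ℝ) + 5 / 2 ∧ 1 / 2 ≤ signlessGap G := by
  classical
  obtain ⟨e⟩ := hG
  have hcard : 2 ≤ Fintype.card V := by
    rw [Fintype.card_congr e.toEquiv]
    simp
    omega
  have hedge : (G.edgeFinset.card : ℝ) = 3 * r + s + 2 * t := by
    rw [e.card_edgeFinset_eq, card_edgeFinset_fireflyGraph]
  have hself (x : V → ℝ) : (x ∘ e.symm) ⬝ᵥ (x ∘ e.symm) = x ⬝ᵥ x :=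
    Fintype.sum_equiv e.symm.toEquiv _ _ fun _ => rfl
  let hA := signlessLaplacian_isHermitian G
  -- This is the equivalence by which `eigenvalues` reindexes the sorted list `eigenvalues₀`.
  let σ : Fin (Fintype.card V) ≃ V := Fintype.equivOfCardEq (Fintype.card_fin _)
  have hσ (k : Fin (Fintype.card V)) : hA.eigenvalues (σ k) = hA.eigenvalues₀ k :=
    congrArg hA.eigenvalues₀ (σ.symm_apply_apply k)
  have h1 : qEigenvalue G 1 ≤ 2 * r + s + t + 2 := by
    rw [qEigenvalue, dif_pos ⟨le_rfl, by omega⟩, ← hσ]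
    refine hA.eigenvalues_le_of_form_le (fun x => ?_) _
    rw [dotProduct_signlessLaplacian_iso e, ← hself]
    exact fireflyGraph_form_le r s t (by omega) _
  have h2 : qEigenvalue G 2 ≤ 3 := by
    rw [qEigenvalue, dif_pos ⟨by omega, hcard⟩, ← hσ]
    refine hA.eigenvalues_le_of_form_le_of_apply_eq_zero (e.symm (.inl ())) (fun x hx => ?_)
      (i := σ ⟨0, by omega⟩) (σ.injective.ne (by simp)) ?_
    · rw [dotProduct_signlessLaplacian_iso e, ← hself]
      exact fireflyGraph_form_le_of_center_eq_zero r s t _ hx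
    · rw [hσ, hσ]
      exact hA.eigenvalues₀_antitone (Fin.mk_le_mk.mpr (Nat.zero_le _))
  have hr' : (2 : ℝ) ≤ r := by exact_mod_cast hr
  have ht' : (1 : ℝ) ≤ t := by exact_mod_cast ht
  rw [signlessGap, signlessS2, hedge]
  constructor <;> linarith
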